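/- **Theorem 2 (Practical stability).** Let $A\in\mathbb R^{n\times n}$, $B\in\mathbb R^{n\times m}$, let $Q\in\mathbb R^{n\times n}$ and $R\in\mathbb R^{m\times m}$ be symmetric positive definite, let $\alpha\ge 0$, and let $\mathcal I^0\subset\{1,2,\dots\}$ be finite and non-empty, $\gamma=\max\mathcal I^0$. Put $A^{(i)}=A^i$, $B^{(i)}=\sum_{q=0}^{i-1}A^qB$, $Q^{(1)}=Q$, $R^{(1)}=R$, $N^{(1)}=0$ and, for $i\ge 2$, $$Q^{(i)}=Q^{(i-1)}+{A^{(i-1)}}^{T}QA^{(i-1)},\quad R^{(i)}=R^{(i-1)}+{B^{(i-1)}}^{T}QB^{(i-1)}+R,\quad N^{(i)}=N^{(i-1)}+{A^{(i-1)}}^{T}QB^{(i-1)}.$$ Assume that $(A,B)$ is controllable, that the set of those $i\in\mathcal I^0$ for which no complex eigenvalue $\lambda\neq 1$ of $A$ satisfies $\lambda^i=1$ is non-empty, let $p^*$ be its largest element, and assume that the down-sampled pair $(A^{(p^*)},B^{(p^*)})$ is controllable. (Controllability of a pair is the Kalman rank condition.) Then: 1. There is exactly one symmetric positive semidefinite matrix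 $P^{(p^*)}$ such that the matrices defined for all $i\geq 1$ by $$L^{(i)}=\big(R^{(i)}+{B^{(i)}}^{T}P^{(p^*)}B^{(i)}\big)^{-1}\big({A^{(i)}}^{T}P^{(p^*)}B^{(i)}+N^{(i)}\big)^{T},$$ $$P^{(i)}=Q^{(i)}+{A^{(i)}}^{T}P^{(p^*)}A^{(i)}-\big({A^{(i)}}^{T}P^{(p^*)}B^{(i)}+N^{(i)}\big)L^{(i)}$$ are consistent at $i=p^*$, that is, $P^{(p^*)}$ solves the Riccati equation obtained from the second formula with $i=p^*$. 2. There is a largest $\epsilon\in(0,1]$ such that, in the order of symmetric matrices, $$\big(A^{(i)}-B^{(i)}L^{(i)}\big)^{T}P^{(p^*)}\big(A^{(i)}-B^{(i)}L^{(i)}\big)\le(1-\epsilon)P^{(i)}\qquad\text{for all } i\in\mathcal I^0 .$$ 3. Consider any trajectory of $x(k+1)=Ax(k)+Bu(k)$, $k\ge 0$, under the single-loop self-triggered MPC: the sampling instants are $t_0=0$, $t_{j+1}=t_j+I_j$, where $I_j$ is a minimizer (any one, in case of ties) of $\frac{\alpha}{i}+x(t_j)^{T}P^{(i)}x(t_j)$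 over $i\in\mathcal I^0$, and $u(k)=-L^{(I_j)}x(t_j)$ for $t_j\le k<t_{j+1}$. With $V(x)=\min_{i\in\mathcal I^0}\big(\frac{\alpha}{i}+x^{T}P^{(i)}x\big)$ one has $$\frac{\alpha}{\gamma}\le V(x(k))\ \text{ for all } k\ge 0,\qquad \limsup_{j\to\infty}V(x(t_j))\le\frac{\alpha}{\epsilon}\Big(\frac1{p^*}-(1-\epsilon)\frac1\gamma\Big).$$ -/

import Mathlib

namespace SelfTriggered

open Matrix

noncomputable section

variable {n m : ℕ}

/-- Kalman rank condition: the matrix `[B, A B, …, A^(n-1) B]` has rank `n`. -/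
def Controllable (A : Matrix (Fin n) (Fin n) ℝ) (B : Matrix (Fin n) (Fin m) ℝ) : Prop :=
  (Matrix.of fun (r : Fin n) (c : Fin n × Fin m) => (A ^ (c.1 : ℕ) * B) r c.2).rank = n

/-- The set `λ(A)` of complex eigenvalues of a real matrix. -/
def eigenvalues (A : Matrix (Fin n) (Fin n) ℝ) : Set ℂ :=
  {z | Module.End.HasEigenvalue (Matrix.toLin' (A.map ((↑) : ℝ → ℂ))) z}

/-- The weighted squared norm `‖x‖²_P = xᵀ P x`. -/
def sqNorm (P : Matrix (Fin n) (Fin n) ℝ) (x : Fin n → ℝ) : ℝ :=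
  x ⬝ᵥ (P *ᵥ x)

/-- `A^(i) = A^i`. -/
def liftA (A : Matrix (Fin n) (Fin n) ℝ) (i : ℕ) : Matrix (Fin n) (Fin n) ℝ :=
  A ^ i

/-- `B^(i) = ∑_{q < i} A^q B`. -/
def liftB (A : Matrix (Fin n) (Fin n) ℝ) (B : Matrix (Fin n) (Fin m) ℝ) (i : ℕ) :
    Matrix (Fin n) (Fin m) ℝ :=
  ∑ q ∈ Finset.range i, A ^ q * B

/-- `Q^(i)`. The recursion is started at `0` with the zero matrix, so that `Q^(1) = Q`. -/
def liftQ (A Q : Matrix (Fin n) (Fin n) ℝ) : ℕ → Matrix (Fin n) (Fin n) ℝ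
  | 0 => 0
  | i + 1 => liftQ A Q i + (liftA A i)ᵀ * Q * liftA A i

/-- `R^(i)`. The recursion is started at `0` with the zero matrix, so that `R^(1) = R`. -/
def liftR (A : Matrix (Fin n) (Fin n) ℝ) (B : Matrix (Fin n) (Fin m) ℝ)
    (Q : Matrix (Fin n) (Fin n) ℝ) (R : Matrix (Fin m) (Fin m) ℝ) :
    ℕ → Matrix (Fin m) (Fin m) ℝ
  | 0 => 0
  | i + 1 => liftR A B Q R i + (liftB A B i)ᵀ * Q * liftB A B i + R

/-- `N^(i)`. The recursion is started at `0` with the zero matrix, so that `N^(1) = 0`. -/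
def liftN (A : Matrix (Fin n) (Fin n) ℝ) (B : Matrix (Fin n) (Fin m) ℝ)
    (Q : Matrix (Fin n) (Fin n) ℝ) : ℕ → Matrix (Fin n) (Fin m) ℝ
  | 0 => 0
  | i + 1 => liftN A B Q i + (liftA A i)ᵀ * Q * liftB A B i

/-- The gain `L^(i)` for the terminal weight `S` (which will be `P^(p)`). -/
def gain (A : Matrix (Fin n) (Fin n) ℝ) (B : Matrix (Fin n) (Fin m) ℝ)
    (Q : Matrix (Fin n) (Fin n) ℝ) (R : Matrix (Fin m) (Fin m) ℝ)
    (S : Matrix (Fin n) (Fin n) ℝ) (i : ℕ) : Matrix (Fin m) (Fin n) ℝ :=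
  (liftR A B Q R i + (liftB A B i)ᵀ * S * liftB A B i)⁻¹ *
    ((liftA A i)ᵀ * S * liftB A B i + liftN A B Q i)ᵀ

/-- The cost matrix `P^(i)` for the terminal weight `S` (which will be `P^(p)`). -/
def costMatrix (A : Matrix (Fin n) (Fin n) ℝ) (B : Matrix (Fin n) (Fin m) ℝ)
    (Q : Matrix (Fin n) (Fin n) ℝ) (R : Matrix (Fin m) (Fin m) ℝ)
    (S : Matrix (Fin n) (Fin n) ℝ) (i : ℕ) : Matrix (Fin n) (Fin n) ℝ :=
  liftQ A Q i + (liftA A i)ᵀ * S * liftA A i -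
    ((liftA A i)ᵀ * S * liftB A B i + liftN A B Q i) * gain A B Q R S i

/-- `P` is a symmetric positive semidefinite solution of the `p`-periodic Riccati equation. -/
def IsRiccatiSolution (A : Matrix (Fin n) (Fin n) ℝ) (B : Matrix (Fin n) (Fin m) ℝ)
    (Q : Matrix (Fin n) (Fin n) ℝ) (R : Matrix (Fin m) (Fin m) ℝ) (p : ℕ)
    (P : Matrix (Fin n) (Fin n) ℝ) : Prop :=
  P.PosSemidef ∧ P = costMatrix A B Q R P p

/-- The cost `α / i + ‖x‖²_{P^(i)}`, where `P` is the terminal weight `P^(p)`. -/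
def cost (A : Matrix (Fin n) (Fin n) ℝ) (B : Matrix (Fin n) (Fin m) ℝ)
    (Q : Matrix (Fin n) (Fin n) ℝ) (R : Matrix (Fin m) (Fin m) ℝ) (α : ℝ)
    (P : Matrix (Fin n) (Fin n) ℝ) (i : ℕ) (x : Fin n → ℝ) : ℝ :=
  α / (i : ℝ) + sqNorm (costMatrix A B Q R P i) x

/-- The optimal cost `min_{i ∈ I₀} (α / i + ‖x‖²_{P^(i)})`. -/
def optCost (A : Matrix (Fin n) (Fin n) ℝ) (B : Matrix (Fin n) (Fin m) ℝ)
    (Q : Matrix (Fin n) (Fin n) ℝ) (R : Matrix (Fin m) (Fin m) ℝ) (α : ℝ)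
    (P : Matrix (Fin n) (Fin n) ℝ) (I₀ : Finset ℕ) (hI₀ : I₀.Nonempty) (x : Fin n → ℝ) : ℝ :=
  I₀.inf' hI₀ fun i => cost A B Q R α P i x

/-- The set of admissible waiting times `i ∈ I₀` such that no eigenvalue `z ≠ 1` of `A`
satisfies `z ^ i = 1`. -/
def admissiblePeriods (A : Matrix (Fin n) (Fin n) ℝ) (I₀ : Finset ℕ) : Set ℕ :=
  {i | i ∈ I₀ ∧ ∀ z ∈ eigenvalues A, z ≠ 1 → z ^ i ≠ 1}

/-- The set of `ε ∈ (0, 1]` with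
`(A^(i) - B^(i) L^(i))ᵀ P (A^(i) - B^(i) L^(i)) ≤ (1 - ε) P^(i)` (Loewner order) for all
`i ∈ I₀`. -/
def decayRates (A : Matrix (Fin n) (Fin n) ℝ) (B : Matrix (Fin n) (Fin m) ℝ)
    (Q : Matrix (Fin n) (Fin n) ℝ) (R : Matrix (Fin m) (Fin m) ℝ)
    (P : Matrix (Fin n) (Fin n) ℝ) (I₀ : Finset ℕ) : Set ℝ :=
  {ε | ε ∈ Set.Ioc (0 : ℝ) 1 ∧ ∀ i ∈ I₀,
    ((1 - ε) • costMatrix A B Q R P i -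
      (liftA A i - liftB A B i * gain A B Q R P i)ᵀ * P *
        (liftA A i - liftB A B i * gain A B Q R P i)).PosSemidef}

/-- `x`, `u` is a closed-loop trajectory produced by the single-loop self-triggered MPC. The
`j`-th sample is taken at time `t j`, the waiting time `I j` chosen there is any minimizer of
the cost over `I₀`, and the input is held until the next sample. -/
structure IsClosedLoop (A : Matrix (Fin n) (Fin n) ℝ) (B : Matrix (Fin n) (Fin m) ℝ)
    (Q : Matrix (Fin n) (Fin n) ℝ) (R : Matrix (Fin m) (Fin m) ℝ) (α : ℝ)
    (P : Matrix (Fin n) (Fin n) ℝ) (I₀ : Finset ℕ)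
    (x : ℕ → Fin n → ℝ) (u : ℕ → Fin m → ℝ) (t I : ℕ → ℕ) : Prop where
  dynamics : ∀ k, x (k + 1) = A *ᵥ x k + B *ᵥ u k
  first_sample : t 0 = 0
  next_sample : ∀ j, t (j + 1) = t j + I j
  wait_mem : ∀ j, I j ∈ I₀
  wait_optimal : ∀ j, ∀ i ∈ I₀,
    cost A B Q R α P (I j) (x (t j)) ≤ cost A B Q R α P i (x (t j))
  input : ∀ j k, t j ≤ k → k < t (j + 1) → u k = -(gain A B Q R P (I j) *ᵥ x (t j))

end

end SelfTriggered

/-! Holding an input `u` for `i` steps and then paying the terminal cost `S` is a quadratic in `u`;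
completing the square (`stageCost_add_terminal`) shows that its minimum is the form of `costMatrix`,
attained at minus the gain times the state. Hence any test input bounds that form from above, and
the map from `S` to the cost matrix is monotone.

Existence of the Riccati solution: value iteration from zero increases, and it is bounded because
controllability of the lifted pair steers every state to the origin in `n` periods at finite cost.
Its limit is a fixed point by continuity. Uniqueness: the closed loop of one solution contracts, and
its inputs are admissible in the problem of the other (`IsRiccatiSolution.sqNorm_le`).

Decay: one closed-loop interval lowers the cost by at least `sqNorm Q x`, and `Q` dominates a
multiple of every cost matrix. At the next sample `V` is at most the cost of the choice `p`, whose
quadratic part is `P` itself by the Riccati equation. This yields the affine contraction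
`IsClosedLoop.optCost_succ_le`, and iterating it gives the limsup bound. -/

namespace SelfTriggered

open Matrix Filter Topology

/-! ### Quadratic forms of real matrices -/

section QuadraticForms

variable {n m k : ℕ}

theorem sqNorm_add (P P' : Matrix (Fin n) (Fin n) ℝ) (x : Fin n → ℝ) :
    sqNorm (P + P') x = sqNorm P x + sqNorm P' x := by
  simp [sqNorm, add_mulVec]

theorem sqNorm_sub (P P' : Matrix (Fin n) (Fin n) ℝ) (x : Fin n → ℝ) :
    sqNorm (P - P') x = sqNorm P x - sqNorm P' x := by
  simp [sqNorm, sub_mulVec]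

theorem sqNorm_smul (c : ℝ) (P : Matrix (Fin n) (Fin n) ℝ) (x : Fin n → ℝ) :
    sqNorm (c • P) x = c * sqNorm P x := by
  simp [sqNorm, smul_mulVec]

theorem sqNorm_sum {ι : Type*} (s : Finset ι) (P : ι → Matrix (Fin n) (Fin n) ℝ)
    (x : Fin n → ℝ) : sqNorm (∑ i ∈ s, P i) x = ∑ i ∈ s, sqNorm (P i) x := by
  simp [sqNorm, sum_mulVec, dotProduct_sum]

theorem sqNorm_smul_vec (c : ℝ) (P : Matrix (Fin n) (Fin n) ℝ) (x : Fin n → ℝ) :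
    sqNorm P (c • x) = c ^ 2 * sqNorm P x := by
  simp [sqNorm, mulVec_smul]; ring

@[simp]
theorem sqNorm_zero_left (x : Fin n → ℝ) : sqNorm (0 : Matrix (Fin n) (Fin n) ℝ) x = 0 := by
  simp [sqNorm]

@[simp]
theorem sqNorm_zero_right (P : Matrix (Fin n) (Fin n) ℝ) : sqNorm P 0 = 0 := by
  simp [sqNorm]

theorem sqNorm_transpose_mul_mul (S : Matrix (Fin n) (Fin n) ℝ) (C : Matrix (Fin n) (Fin k) ℝ)
    (x : Fin k → ℝ) : sqNorm (Cᵀ * S * C) x = sqNorm S (C *ᵥ x) := by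
  simp only [sqNorm, ← mulVec_mulVec]
  rw [dotProduct_mulVec x Cᵀ, vecMul_transpose]

theorem sqNorm_nonneg {P : Matrix (Fin n) (Fin n) ℝ} (hP : P.PosSemidef) (x : Fin n → ℝ) :
    0 ≤ sqNorm P x := by
  simpa [sqNorm] using hP.dotProduct_mulVec_nonneg x

theorem sqNorm_pos {P : Matrix (Fin n) (Fin n) ℝ} (hP : P.PosDef) {x : Fin n → ℝ} (hx : x ≠ 0) :
    0 < sqNorm P x := by
  simpa [sqNorm] using hP.dotProduct_mulVec_pos hx

theorem posSemidef_of_sqNorm_nonneg {P : Matrix (Fin n) (Fin n) ℝ} (hP : P.IsHermitian)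
    (h : ∀ x, 0 ≤ sqNorm P x) : P.PosSemidef :=
  .of_dotProduct_mulVec_nonneg hP fun x => by simpa [sqNorm] using h x

theorem transpose_eq_of_isHermitian {P : Matrix (Fin n) (Fin n) ℝ} (hP : P.IsHermitian) :
    Pᵀ = P := by
  simpa [IsHermitian, conjTranspose_eq_transpose_of_trivial] using hP

theorem isHermitian_of_transpose_eq {P : Matrix (Fin n) (Fin n) ℝ} (hP : Pᵀ = P) :
    P.IsHermitian := by
  simpa [IsHermitian, conjTranspose_eq_transpose_of_trivial] using hP

theorem dotProduct_mulVec_comm {P : Matrix (Fin n) (Fin n) ℝ} (hP : Pᵀ = P) (x y : Fin n → ℝ) :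
    x ⬝ᵥ (P *ᵥ y) = y ⬝ᵥ (P *ᵥ x) := by
  rw [dotProduct_mulVec, ← mulVec_transpose, hP, dotProduct_comm]

theorem sqNorm_add_vec {P : Matrix (Fin n) (Fin n) ℝ} (hP : Pᵀ = P) (x y : Fin n → ℝ) :
    sqNorm P (x + y) = sqNorm P x + 2 * (x ⬝ᵥ (P *ᵥ y)) + sqNorm P y := by
  simp only [sqNorm, mulVec_add, dotProduct_add, add_dotProduct, dotProduct_mulVec_comm hP y x]
  ring

theorem apply_eq_sqNorm {P : Matrix (Fin n) (Fin n) ℝ} (hP : Pᵀ = P) (i j : Fin n) :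
    P i j = (sqNorm P (Pi.single i 1 + Pi.single j 1) - sqNorm P (Pi.single i 1)
      - sqNorm P (Pi.single j 1)) / 2 := by
  have h : Pi.single i 1 ⬝ᵥ (P *ᵥ Pi.single j 1) = P i j := by simp
  rw [sqNorm_add_vec hP, h]
  ring

theorem eq_of_sqNorm_eq {P P' : Matrix (Fin n) (Fin n) ℝ} (hP : Pᵀ = P) (hP' : P'ᵀ = P')
    (h : ∀ x, sqNorm P x = sqNorm P' x) : P = P' := by
  ext i j
  rw [apply_eq_sqNorm hP, apply_eq_sqNorm hP', h, h, h]

theorem sqNorm_mulVec_add_mulVec {S : Matrix (Fin n) (Fin n) ℝ} (hS : Sᵀ = S)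
    (C : Matrix (Fin n) (Fin k) ℝ) (D : Matrix (Fin n) (Fin m) ℝ) (x : Fin k → ℝ)
    (u : Fin m → ℝ) :
    sqNorm S (C *ᵥ x + D *ᵥ u) =
      sqNorm (Cᵀ * S * C) x + 2 * (x ⬝ᵥ ((Cᵀ * S * D) *ᵥ u)) + sqNorm (Dᵀ * S * D) u := by
  rw [sqNorm_add_vec hS, sqNorm_transpose_mul_mul, sqNorm_transpose_mul_mul]
  simp only [← mulVec_mulVec]
  rw [dotProduct_mulVec x Cᵀ, vecMul_transpose]

theorem completing_the_square {M : Matrix (Fin m) (Fin m) ℝ} (hM : M.PosDef)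
    (H : Matrix (Fin n) (Fin n) ℝ) (G : Matrix (Fin n) (Fin m) ℝ) (x : Fin n → ℝ)
    (u : Fin m → ℝ) :
    sqNorm H x + 2 * (x ⬝ᵥ (G *ᵥ u)) + sqNorm M u =
      sqNorm (H - G * (M⁻¹ * Gᵀ)) x + sqNorm M (u + (M⁻¹ * Gᵀ) *ᵥ x) := by
  have hMt : Mᵀ = M := transpose_eq_of_isHermitian hM.isHermitian
  have hdet : IsUnit M.det := hM.det_pos.ne'.isUnit
  have h1 : M *ᵥ ((M⁻¹ * Gᵀ) *ᵥ x) = Gᵀ *ᵥ x := by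
    rw [mulVec_mulVec, ← Matrix.mul_assoc, mul_nonsing_inv _ hdet, Matrix.one_mul]
  have h2 : x ⬝ᵥ (G *ᵥ u) = u ⬝ᵥ (Gᵀ *ᵥ x) := by
    rw [dotProduct_mulVec, ← mulVec_transpose, dotProduct_comm]
  have h3 : sqNorm M ((M⁻¹ * Gᵀ) *ᵥ x) = sqNorm (G * (M⁻¹ * Gᵀ)) x := by
    rw [sqNorm, h1, sqNorm, ← mulVec_mulVec x G, dotProduct_mulVec x G, ← mulVec_transpose,
      dotProduct_comm]
  rw [sqNorm_add_vec hMt, h1, h3, sqNorm_sub, h2]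
  ring

theorem continuous_sqNorm (P : Matrix (Fin n) (Fin n) ℝ) : Continuous (sqNorm P) := by
  unfold sqNorm
  fun_prop

/-- A positive definite form dominates a multiple of any other form. -/
theorem exists_mul_sqNorm_le {Q : Matrix (Fin n) (Fin n) ℝ} (hQ : Q.PosDef)
    (P : Matrix (Fin n) (Fin n) ℝ) :
    ∃ δ ∈ Set.Ioc (0 : ℝ) 1, ∀ x, δ * sqNorm P x ≤ sqNorm Q x := by
  have hK : IsCompact (Metric.sphere (0 : Fin n → ℝ) 1) := isCompact_sphere _ _
  obtain ⟨c, hc, hcQ⟩ := hK.exists_forall_le' (continuous_sqNorm Q).continuousOn (a := 0)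
    fun x hx => sqNorm_pos hQ (by rintro rfl; simp at hx)
  obtain ⟨C, hC⟩ := hK.bddAbove_image (continuous_sqNorm P).continuousOn
  -- `P` is arbitrary, so `C` may be nonpositive; the maximum with `c` keeps the denominator
  -- positive and the quotient at most 1.
  have hC' : ∀ x ∈ Metric.sphere (0 : Fin n → ℝ) 1, sqNorm P x ≤ max C c :=
    fun x hx => (hC ⟨x, hx, rfl⟩).trans (le_max_left _ _)
  have hD : 0 < max C c := lt_max_of_lt_right hc
  refine ⟨c / max C c, ⟨by positivity, div_le_one_of_le₀ (le_max_right _ _) hD.le⟩, fun x => ?_⟩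
  rcases eq_or_ne x 0 with rfl | hx
  · simp
  have hnx : ‖x‖ ≠ 0 := norm_ne_zero_iff.2 hx
  have hy : ‖x‖⁻¹ • x ∈ Metric.sphere (0 : Fin n → ℝ) 1 := by
    simp [norm_smul, hnx]
  have hxy : x = ‖x‖ • (‖x‖⁻¹ • x) := by rw [smul_smul, mul_inv_cancel₀ hnx, one_smul]
  generalize ‖x‖⁻¹ • x = y at hy hxy
  rw [hxy, sqNorm_smul_vec, sqNorm_smul_vec]
  have h1 : c / max C c * sqNorm P y ≤ sqNorm Q y :=
    calc c / max C c * sqNorm P y ≤ c / max C c * max C c := by gcongr; exact hC' y hy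
      _ = c := div_mul_cancel₀ _ hD.ne'
      _ ≤ _ := hcQ y hy
  calc c / max C c * (‖x‖ ^ 2 * sqNorm P y) = ‖x‖ ^ 2 * (c / max C c * sqNorm P y) := by ring
    _ ≤ ‖x‖ ^ 2 * sqNorm Q y := by gcongr

end QuadraticForms

/-! ### Cost over one sampling interval with held input -/

section LiftedCost

variable {n m : ℕ} {A : Matrix (Fin n) (Fin n) ℝ} {B : Matrix (Fin n) (Fin m) ℝ}
  {Q : Matrix (Fin n) (Fin n) ℝ} {R : Matrix (Fin m) (Fin m) ℝ}
  {S S' : Matrix (Fin n) (Fin n) ℝ} {i : ℕ}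

/-- The cost accumulated over `i` steps from the state `x` under the constant input `u`. -/
def stageCost (A : Matrix (Fin n) (Fin n) ℝ) (B : Matrix (Fin n) (Fin m) ℝ)
    (Q : Matrix (Fin n) (Fin n) ℝ) (R : Matrix (Fin m) (Fin m) ℝ) (i : ℕ)
    (x : Fin n → ℝ) (u : Fin m → ℝ) : ℝ :=
  ∑ k ∈ Finset.range i, (sqNorm Q (liftA A k *ᵥ x + liftB A B k *ᵥ u) + sqNorm R u)

/-- The recursions for `liftQ`, `liftN`, `liftR` collect the coefficients obtained by expanding each
summand in `x` and `u`. -/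
theorem stageCost_eq (hQ : Qᵀ = Q) (i : ℕ) (x : Fin n → ℝ) (u : Fin m → ℝ) :
    stageCost A B Q R i x u =
      sqNorm (liftQ A Q i) x + 2 * (x ⬝ᵥ (liftN A B Q i *ᵥ u)) + sqNorm (liftR A B Q R i) u := by
  induction i with
  | zero => simp [stageCost, liftQ, liftN, liftR]
  | succ i ih =>
    have h : stageCost A B Q R (i + 1) x u = stageCost A B Q R i x u +
        (sqNorm Q (liftA A i *ᵥ x + liftB A B i *ᵥ u) + sqNorm R u) :=
      Finset.sum_range_succ _ _
    rw [h, ih, sqNorm_mulVec_add_mulVec hQ]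
    simp only [liftQ, liftN, liftR, sqNorm_add, add_mulVec, dotProduct_add]
    ring

theorem sqNorm_le_stageCost (hQ : Q.PosSemidef) (hR : R.PosSemidef) (hi : 0 < i)
    (x : Fin n → ℝ) (u : Fin m → ℝ) : sqNorm Q x ≤ stageCost A B Q R i x u := by
  have h := Finset.single_le_sum (s := Finset.range i) (a := 0)
    (f := fun k => sqNorm Q (liftA A k *ᵥ x + liftB A B k *ᵥ u) + sqNorm R u)
    (fun k _ => add_nonneg (sqNorm_nonneg hQ _) (sqNorm_nonneg hR _)) (Finset.mem_range.2 hi)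
  have h0 : sqNorm Q (liftA A 0 *ᵥ x + liftB A B 0 *ᵥ u) = sqNorm Q x := by
    simp [liftA, liftB]
  have h1 := sqNorm_nonneg hR u
  unfold stageCost
  linarith

theorem transpose_liftQ (hQ : Qᵀ = Q) (i : ℕ) : (liftQ A Q i)ᵀ = liftQ A Q i := by
  induction i with
  | zero => simp [liftQ]
  | succ i ih => simp [liftQ, ih, hQ, Matrix.mul_assoc]

theorem posSemidef_transpose_mul_mul {k : ℕ} (hS : S.PosSemidef) (C : Matrix (Fin n) (Fin k) ℝ) :
    (Cᵀ * S * C).PosSemidef := by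
  simpa [conjTranspose_eq_transpose_of_trivial] using hS.conjTranspose_mul_mul_same C

theorem posSemidef_liftR (hQ : Q.PosSemidef) (hR : R.PosSemidef) (i : ℕ) :
    (liftR A B Q R i).PosSemidef := by
  induction i with
  | zero => exact .zero
  | succ i ih => exact (ih.add (posSemidef_transpose_mul_mul hQ _)).add hR

theorem posDef_liftR (hQ : Q.PosSemidef) (hR : R.PosDef) (hi : 0 < i) :
    (liftR A B Q R i).PosDef := by
  obtain ⟨i, rfl⟩ := Nat.exists_eq_add_one.2 hi
  exact .posSemidef_add
    ((posSemidef_liftR hQ hR.posSemidef i).add (posSemidef_transpose_mul_mul hQ _)) hR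

theorem posDef_liftR_add (hQ : Q.PosSemidef) (hR : R.PosDef) (hS : S.PosSemidef) (hi : 0 < i) :
    (liftR A B Q R i + (liftB A B i)ᵀ * S * liftB A B i).PosDef :=
  (posDef_liftR hQ hR hi).add_posSemidef (posSemidef_transpose_mul_mul hS _)

/-- The cost over `i` steps followed by the terminal cost `S`, as a completed square. -/
theorem stageCost_add_terminal (hQ : Q.PosSemidef) (hR : R.PosDef) (hS : S.PosSemidef)
    (hi : 0 < i) (x : Fin n → ℝ) (u : Fin m → ℝ) :
    stageCost A B Q R i x u + sqNorm S (liftA A i *ᵥ x + liftB A B i *ᵥ u) =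
      sqNorm (costMatrix A B Q R S i) x +
        sqNorm (liftR A B Q R i + (liftB A B i)ᵀ * S * liftB A B i)
          (u + gain A B Q R S i *ᵥ x) := by
  have h := completing_the_square (posDef_liftR_add (A := A) (B := B) hQ hR hS hi)
    (liftQ A Q i + (liftA A i)ᵀ * S * liftA A i) ((liftA A i)ᵀ * S * liftB A B i + liftN A B Q i)
    x u
  rw [costMatrix, gain, ← h, stageCost_eq (transpose_eq_of_isHermitian hQ.isHermitian),
    sqNorm_mulVec_add_mulVec (transpose_eq_of_isHermitian hS.isHermitian)]
  simp only [sqNorm_add, add_mulVec, dotProduct_add]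
  ring

theorem sqNorm_costMatrix_le (hQ : Q.PosSemidef) (hR : R.PosDef) (hS : S.PosSemidef)
    (hi : 0 < i) (x : Fin n → ℝ) (u : Fin m → ℝ) :
    sqNorm (costMatrix A B Q R S i) x ≤
      stageCost A B Q R i x u + sqNorm S (liftA A i *ᵥ x + liftB A B i *ᵥ u) := by
  rw [stageCost_add_terminal hQ hR hS hi]
  exact le_add_of_nonneg_right (sqNorm_nonneg (posDef_liftR_add hQ hR hS hi).posSemidef _)

theorem liftA_mulVec_add_liftB_mulVec_gain (x : Fin n → ℝ) :
    liftA A i *ᵥ x + liftB A B i *ᵥ -(gain A B Q R S i *ᵥ x) =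
      (liftA A i - liftB A B i * gain A B Q R S i) *ᵥ x := by
  rw [sub_mulVec, ← mulVec_mulVec, mulVec_neg, sub_eq_add_neg]

theorem sqNorm_costMatrix_eq (hQ : Q.PosSemidef) (hR : R.PosDef) (hS : S.PosSemidef)
    (hi : 0 < i) (x : Fin n → ℝ) :
    sqNorm (costMatrix A B Q R S i) x =
      stageCost A B Q R i x (-(gain A B Q R S i *ᵥ x)) +
        sqNorm S ((liftA A i - liftB A B i * gain A B Q R S i) *ᵥ x) := by
  rw [← liftA_mulVec_add_liftB_mulVec_gain, stageCost_add_terminal hQ hR hS hi]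
  simp

theorem sqNorm_closedLoop_le (hQ : Q.PosSemidef) (hR : R.PosDef) (hS : S.PosSemidef)
    (hi : 0 < i) (x : Fin n → ℝ) :
    sqNorm S ((liftA A i - liftB A B i * gain A B Q R S i) *ᵥ x) ≤
      sqNorm (costMatrix A B Q R S i) x - sqNorm Q x := by
  rw [sqNorm_costMatrix_eq hQ hR hS hi]
  linarith [sqNorm_le_stageCost (A := A) (B := B) hQ hR.posSemidef hi x
    (-(gain A B Q R S i *ᵥ x))]

theorem sqNorm_le_sqNorm_costMatrix (hQ : Q.PosSemidef) (hR : R.PosDef) (hS : S.PosSemidef)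
    (hi : 0 < i) (x : Fin n → ℝ) : sqNorm Q x ≤ sqNorm (costMatrix A B Q R S i) x := by
  have h := sqNorm_closedLoop_le (A := A) (B := B) hQ hR hS hi x
  linarith [sqNorm_nonneg hS ((liftA A i - liftB A B i * gain A B Q R S i) *ᵥ x)]

theorem transpose_costMatrix (hQ : Q.PosSemidef) (hR : R.PosDef) (hS : S.PosSemidef)
    (hi : 0 < i) : (costMatrix A B Q R S i)ᵀ = costMatrix A B Q R S i := by
  have hM := transpose_eq_of_isHermitian
    (posDef_liftR_add (A := A) (B := B) (i := i) hQ hR hS hi).isHermitian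
  have hSt := transpose_eq_of_isHermitian hS.isHermitian
  have hQt := transpose_liftQ (A := A) (transpose_eq_of_isHermitian hQ.isHermitian) i
  have h1 : ((liftA A i)ᵀ * S * liftA A i)ᵀ = (liftA A i)ᵀ * S * liftA A i := by
    simp [hSt, Matrix.mul_assoc]
  unfold costMatrix gain
  generalize (liftA A i)ᵀ * S * liftB A B i + liftN A B Q i = G
  rw [transpose_sub, transpose_add, hQt, h1, transpose_mul, transpose_mul, transpose_transpose,
    transpose_nonsing_inv, hM, Matrix.mul_assoc G]

theorem posSemidef_costMatrix (hQ : Q.PosSemidef) (hR : R.PosDef) (hS : S.PosSemidef)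
    (hi : 0 < i) : (costMatrix A B Q R S i).PosSemidef :=
  posSemidef_of_sqNorm_nonneg (isHermitian_of_transpose_eq (transpose_costMatrix hQ hR hS hi))
    fun x => (sqNorm_nonneg hQ x).trans (sqNorm_le_sqNorm_costMatrix hQ hR hS hi x)

/-- The input that is optimal for `S'` serves as a test input for `S`. -/
theorem sqNorm_costMatrix_mono (hQ : Q.PosSemidef) (hR : R.PosDef) (hS : S.PosSemidef)
    (hS' : S'.PosSemidef) (hi : 0 < i) (h : ∀ x, sqNorm S x ≤ sqNorm S' x) (x : Fin n → ℝ) :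
    sqNorm (costMatrix A B Q R S i) x ≤ sqNorm (costMatrix A B Q R S' i) x := by
  rw [sqNorm_costMatrix_eq hQ hR hS' hi, ← liftA_mulVec_add_liftB_mulVec_gain]
  exact (sqNorm_costMatrix_le hQ hR hS hi x _).trans (by gcongr; exact h _)

theorem continuousAt_costMatrix (hQ : Q.PosSemidef) (hR : R.PosDef) (hS : S.PosSemidef)
    (hi : 0 < i) : ContinuousAt (fun S => costMatrix A B Q R S i) S := by
  have hinv : ContinuousAt
      (fun S => (liftR A B Q R i + (liftB A B i)ᵀ * S * liftB A B i)⁻¹) S := by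
    have hdet := (posDef_liftR_add (A := A) (B := B) hQ hR hS hi).det_pos.ne'
    refine ContinuousAt.comp (g := Inv.inv) (continuousAt_matrix_inv _ ?_)
      (Continuous.continuousAt (by fun_prop))
    rw [Ring.inverse_eq_inv']
    exact continuousAt_inv₀ hdet
  have hG : Continuous fun S => (liftA A i)ᵀ * S * liftB A B i + liftN A B Q i := by fun_prop
  have hH : Continuous fun S => liftQ A Q i + (liftA A i)ᵀ * S * liftA A i := by fun_prop
  have hmul {a b c : ℕ} : Continuous fun q : Matrix (Fin a) (Fin b) ℝ × Matrix (Fin b) (Fin c) ℝ =>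
      q.1 * q.2 := continuous_fst.matrix_mul continuous_snd
  exact hH.continuousAt.sub <| hmul.continuousAt.comp₂ hG.continuousAt <|
    hmul.continuousAt.comp₂ hinv hG.matrix_transpose.continuousAt

end LiftedCost

/-! ### Existence and uniqueness of the Riccati solution -/

section Riccati

variable {n m : ℕ} {A : Matrix (Fin n) (Fin n) ℝ} {B : Matrix (Fin n) (Fin m) ℝ}
  {Q : Matrix (Fin n) (Fin n) ℝ} {R : Matrix (Fin m) (Fin m) ℝ} {p : ℕ}

theorem isClosed_posSemidef : IsClosed {P : Matrix (Fin n) (Fin n) ℝ | P.PosSemidef} := by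
  have h : {P : Matrix (Fin n) (Fin n) ℝ | P.PosSemidef} =
      {P | Pᵀ = P} ∩ ⋂ x, {P | 0 ≤ sqNorm P x} := by
    ext P
    simp only [Set.mem_inter_iff, Set.mem_iInter, Set.mem_ofPred_eq]
    exact ⟨fun hP => ⟨transpose_eq_of_isHermitian hP.isHermitian, sqNorm_nonneg hP⟩,
      fun hP => posSemidef_of_sqNorm_nonneg (isHermitian_of_transpose_eq hP.1) hP.2⟩
  rw [h]
  refine (isClosed_eq (by fun_prop) continuous_id).inter (isClosed_iInter fun x => ?_)
  exact isClosed_le continuous_const (by unfold sqNorm; fun_prop)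

/-- By polarization (`apply_eq_sqNorm`) each entry is a combination of three values of the form, and
these converge. -/
theorem exists_tendsto_of_monotone_bounded {V : ℕ → Matrix (Fin n) (Fin n) ℝ}
    (hV : ∀ k, (V k)ᵀ = V k) (hmono : ∀ x, Monotone fun k => sqNorm (V k) x)
    (hbdd : ∀ x, ∃ C, ∀ k, sqNorm (V k) x ≤ C) : ∃ P, Tendsto V atTop (𝓝 P) := by
  have hlim (x) : ∃ l, Tendsto (fun k => sqNorm (V k) x) atTop (𝓝 l) := by
    obtain ⟨C, hC⟩ := hbdd x
    exact ⟨_, tendsto_atTop_ciSup (hmono x) ⟨C, by rintro _ ⟨k, rfl⟩; exact hC k⟩⟩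
  choose l hl using hlim
  refine ⟨.of fun i j => (l (Pi.single i 1 + Pi.single j 1) - l (Pi.single i 1)
      - l (Pi.single j 1)) / 2, ?_⟩
  refine tendsto_pi_nhds.2 fun i => tendsto_pi_nhds.2 fun j => ?_
  simp only [fun k => apply_eq_sqNorm (hV k) i j]
  exact (((hl _).sub (hl _)).sub (hl _)).div_const 2

/-- The cost matrices over `k` periods with zero terminal cost. -/
noncomputable def valueIteration (A : Matrix (Fin n) (Fin n) ℝ) (B : Matrix (Fin n) (Fin m) ℝ)
    (Q : Matrix (Fin n) (Fin n) ℝ) (R : Matrix (Fin m) (Fin m) ℝ) (p : ℕ) :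
    ℕ → Matrix (Fin n) (Fin n) ℝ
  | 0 => 0
  | k + 1 => costMatrix A B Q R (valueIteration A B Q R p k) p

theorem posSemidef_valueIteration (hQ : Q.PosSemidef) (hR : R.PosDef) (hp : 0 < p) (k : ℕ) :
    (valueIteration A B Q R p k).PosSemidef := by
  induction k with
  | zero => exact .zero
  | succ k ih => exact posSemidef_costMatrix hQ hR ih hp

theorem monotone_sqNorm_valueIteration (hQ : Q.PosSemidef) (hR : R.PosDef) (hp : 0 < p)
    (x : Fin n → ℝ) : Monotone fun k => sqNorm (valueIteration A B Q R p k) x := by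
  refine monotone_nat_of_le_succ fun k => ?_
  induction k generalizing x with
  | zero => simpa [valueIteration] using sqNorm_nonneg (posSemidef_valueIteration hQ hR hp 1) x
  | succ k ih =>
    exact sqNorm_costMatrix_mono hQ hR (posSemidef_valueIteration hQ hR hp _)
      (posSemidef_valueIteration hQ hR hp _) hp ih x

/-- The bound is the cost of the steering inputs: once the origin is reached, nothing more is paid.
-/
theorem valueIteration_bounded_of_steered (hQ : Q.PosSemidef) (hR : R.PosDef) (hp : 0 < p)
    (w : ℕ → Fin m → ℝ) (j : ℕ) (x : Fin n → ℝ)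
    (hx : liftA A p ^ j *ᵥ x +
      ∑ l ∈ Finset.range j, (liftA A p ^ l * liftB A B p) *ᵥ w l = 0) :
    ∃ C, ∀ k, sqNorm (valueIteration A B Q R p k) x ≤ C := by
  induction j generalizing x with
  | zero =>
    obtain rfl : x = 0 := by simpa using hx
    exact ⟨0, fun k => by simp⟩
  | succ j ih =>
    -- `w j` multiplies the highest power of `liftA A p`, so it is the input applied first.
    obtain ⟨C, hC⟩ := ih (liftA A p *ᵥ x + liftB A B p *ᵥ w j) (by
      rw [← hx, Finset.sum_range_succ, mulVec_add, mulVec_mulVec, mulVec_mulVec, pow_succ]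
      abel)
    refine ⟨stageCost A B Q R p x (w j) + C, fun k => ?_⟩
    calc sqNorm (valueIteration A B Q R p k) x
        ≤ sqNorm (valueIteration A B Q R p (k + 1)) x :=
          monotone_sqNorm_valueIteration hQ hR hp x k.le_succ
      _ ≤ _ := sqNorm_costMatrix_le hQ hR (posSemidef_valueIteration hQ hR hp k) hp x (w j)
      _ ≤ _ := by gcongr; exact hC k

theorem Controllable.exists_input (h : Controllable A B) (y : Fin n → ℝ) :
    ∃ w : ℕ → Fin m → ℝ, ∑ l ∈ Finset.range n, (A ^ l * B) *ᵥ w l = y := by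
  obtain ⟨v, hv⟩ : ∃ v, (Matrix.of fun (r : Fin n) (c : Fin n × Fin m) =>
      (A ^ (c.1 : ℕ) * B) r c.2) *ᵥ v = y := by
    have htop := Submodule.eq_top_of_finrank_eq (K := ℝ)
      (S := LinearMap.range (Matrix.of fun (r : Fin n) (c : Fin n × Fin m) =>
        (A ^ (c.1 : ℕ) * B) r c.2).mulVecLin) (by simpa using! h)
    simpa using! LinearMap.range_eq_top.1 htop y
  refine ⟨fun l c => if hl : l < n then v (⟨l, hl⟩, c) else 0, ?_⟩
  rw [← hv, Finset.sum_range]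
  ext r
  simp [mulVec, dotProduct, Fintype.sum_prod_type, Finset.sum_apply]

theorem exists_isRiccatiSolution (hQ : Q.PosSemidef) (hR : R.PosDef) (hp : 0 < p)
    (h : Controllable (liftA A p) (liftB A B p)) : ∃ P, IsRiccatiSolution A B Q R p P := by
  have hV := posSemidef_valueIteration (A := A) (B := B) hQ hR hp
  obtain ⟨P, hP⟩ := exists_tendsto_of_monotone_bounded
    (fun k => transpose_eq_of_isHermitian (hV k).isHermitian)
    (monotone_sqNorm_valueIteration hQ hR hp) fun x => by
      obtain ⟨w, hw⟩ := h.exists_input (-(liftA A p ^ n *ᵥ x))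
      exact valueIteration_bounded_of_steered hQ hR hp w n x (by rw [hw, add_neg_cancel])
  have hPs : P.PosSemidef := isClosed_posSemidef.mem_of_tendsto hP (.of_forall hV)
  exact ⟨P, hPs, tendsto_nhds_unique (hP.comp (tendsto_add_atTop_nat 1))
    ((continuousAt_costMatrix hQ hR hPs hp).tendsto.comp hP)⟩

theorem IsRiccatiSolution.posDef {P : Matrix (Fin n) (Fin n) ℝ}
    (h : IsRiccatiSolution A B Q R p P) (hQ : Q.PosDef) (hR : R.PosDef) (hp : 0 < p) :
    P.PosDef := by
  refine .of_dotProduct_mulVec_pos h.1.isHermitian fun x hx => ?_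
  have h1 := sqNorm_le_sqNorm_costMatrix (A := A) (B := B) hQ.posSemidef hR h.1 hp x
  rw [← h.2] at h1
  simpa [sqNorm] using (sqNorm_pos hQ hx).trans_le h1

/-- Two Riccati solutions are compared along the closed loop of the second one, which is
exponentially stable. -/
theorem IsRiccatiSolution.sqNorm_le {P P' : Matrix (Fin n) (Fin n) ℝ}
    (hP' : IsRiccatiSolution A B Q R p P') (hP : IsRiccatiSolution A B Q R p P)
    (hQ : Q.PosDef) (hR : R.PosDef) (hp : 0 < p) (x : Fin n → ℝ) :
    sqNorm P' x ≤ sqNorm P x := by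
  set F := liftA A p - liftB A B p * gain A B Q R P p with hF
  obtain ⟨δ, ⟨hδ0, hδ1⟩, hδ⟩ := exists_mul_sqNorm_le hQ P
  obtain ⟨c, ⟨hc0, hc1⟩, hc⟩ := exists_mul_sqNorm_le (hP.posDef hQ hR hp) P'
  have hdec (y : Fin n → ℝ) : sqNorm P (F *ᵥ y) ≤ (1 - δ) * sqNorm P y := by
    have h := sqNorm_closedLoop_le (A := A) (B := B) hQ.posSemidef hR hP.1 hp y
    rw [← hP.2] at h
    linarith [hδ y]
  -- The gain of `P` is optimal for `P` and only a test input for `P'`; the common stage cost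
  -- cancels.
  have hstep (y : Fin n → ℝ) :
      sqNorm P' y - sqNorm P y ≤ sqNorm P' (F *ᵥ y) - sqNorm P (F *ᵥ y) := by
    have h1 := sqNorm_costMatrix_eq (A := A) (B := B) hQ.posSemidef hR hP.1 hp y
    have h2 := sqNorm_costMatrix_le (A := A) (B := B) hQ.posSemidef hR hP'.1 hp y
      (-(gain A B Q R P p *ᵥ y))
    rw [← hP.2] at h1
    rw [← hP'.2, liftA_mulVec_add_liftB_mulVec_gain] at h2
    linarith
  have hpow (k : ℕ) : sqNorm P (F ^ k *ᵥ x) ≤ (1 - δ) ^ k * sqNorm P x ∧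
      sqNorm P' x - sqNorm P x ≤ sqNorm P' (F ^ k *ᵥ x) - sqNorm P (F ^ k *ᵥ x) := by
    induction k with
    | zero => simp
    | succ k ih =>
      rw [pow_succ' F, ← mulVec_mulVec]
      refine ⟨(hdec _).trans ?_, ih.2.trans (hstep _)⟩
      rw [pow_succ', mul_assoc]
      exact mul_le_mul_of_nonneg_left ih.1 (by linarith)
  -- As `c * P'` is dominated by `P`, the form of `P'` also decays along the closed loop of `P`.
  have hbound (k : ℕ) : c * (sqNorm P' x - sqNorm P x) ≤ (1 - δ) ^ k * sqNorm P x := by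
    have h0 := sqNorm_nonneg hP.1 (F ^ k *ᵥ x)
    calc c * (sqNorm P' x - sqNorm P x) ≤ c * sqNorm P' (F ^ k *ᵥ x) := by
          gcongr; linarith [(hpow k).2]
      _ ≤ _ := (hc _).trans (hpow k).1
  have hlim : Tendsto (fun k => (1 - δ) ^ k * sqNorm P x) atTop (𝓝 0) := by
    simpa using (tendsto_pow_atTop_nhds_zero_of_lt_one (by linarith) (by linarith)).mul_const
      (sqNorm P x)
  have h := ge_of_tendsto' hlim hbound
  nlinarith

theorem IsRiccatiSolution.unique {P P' : Matrix (Fin n) (Fin n) ℝ}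
    (hP' : IsRiccatiSolution A B Q R p P') (hP : IsRiccatiSolution A B Q R p P)
    (hQ : Q.PosDef) (hR : R.PosDef) (hp : 0 < p) : P' = P :=
  eq_of_sqNorm_eq (transpose_eq_of_isHermitian hP'.1.isHermitian)
    (transpose_eq_of_isHermitian hP.1.isHermitian) fun x =>
      (hP'.sqNorm_le hP hQ hR hp x).antisymm (hP.sqNorm_le hP' hQ hR hp x)

end Riccati

/-! ### Decay rate and closed-loop bounds -/

section ClosedLoop

variable {n m : ℕ} {A : Matrix (Fin n) (Fin n) ℝ} {B : Matrix (Fin n) (Fin m) ℝ}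
  {Q : Matrix (Fin n) (Fin n) ℝ} {R : Matrix (Fin m) (Fin m) ℝ}
  {P : Matrix (Fin n) (Fin n) ℝ} {I₀ : Finset ℕ} {α ε : ℝ}

theorem decayRates_nonempty (hQ : Q.PosDef) (hR : R.PosDef) (hP : P.PosSemidef)
    (hI₀ : ∀ i ∈ I₀, 0 < i) : (decayRates A B Q R P I₀).Nonempty := by
  have hC (i) (hi : i ∈ I₀) : (costMatrix A B Q R P i).PosSemidef :=
    posSemidef_costMatrix hQ.posSemidef hR hP (hI₀ i hi)
  -- Comparing `Q` with the sum gives one `δ` valid for all `i ∈ I₀`.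
  obtain ⟨δ, hδ, hδQ⟩ := exists_mul_sqNorm_le hQ (∑ i ∈ I₀, costMatrix A B Q R P i)
  refine ⟨δ, hδ, fun i hi => ?_⟩
  refine posSemidef_of_sqNorm_nonneg (.sub ?_
    (posSemidef_transpose_mul_mul hP _).isHermitian) fun x => ?_
  · exact ((hC i hi).smul (sub_nonneg.2 hδ.2)).isHermitian
  · have h1 := sqNorm_closedLoop_le (A := A) (B := B) hQ.posSemidef hR hP (hI₀ i hi) x
    have h2 : sqNorm (costMatrix A B Q R P i) x ≤ sqNorm (∑ i ∈ I₀, costMatrix A B Q R P i) x := by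
      rw [sqNorm_sum]
      exact Finset.single_le_sum (f := fun i => sqNorm (costMatrix A B Q R P i) x)
        (fun j hj => sqNorm_nonneg (hC j hj) x) hi
    have h3 := (mul_le_mul_of_nonneg_left h2 hδ.1.le).trans (hδQ x)
    rw [sqNorm_sub, sqNorm_smul, sqNorm_transpose_mul_mul]
    linarith

theorem exists_isGreatest_decayRates (hQ : Q.PosDef) (hR : R.PosDef) (hP : P.PosSemidef)
    (hI₀ : ∀ i ∈ I₀, 0 < i) : ∃ ε, IsGreatest (decayRates A B Q R P I₀) ε := by
  obtain ⟨δ, hδ⟩ := decayRates_nonempty (A := A) (B := B) hQ hR hP hI₀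
  have hcl : IsClosed {ε : ℝ | ∀ i ∈ I₀, ((1 - ε) • costMatrix A B Q R P i -
      (liftA A i - liftB A B i * gain A B Q R P i)ᵀ * P *
        (liftA A i - liftB A B i * gain A B Q R P i)).PosSemidef} := by
    simp only [Set.ofPred_forall]
    exact isClosed_biInter fun i _ => isClosed_posSemidef.preimage (by fun_prop)
  -- `Ioc 0 1` is not compact; cutting at the known rate `δ` loses no candidate for the maximum.
  obtain ⟨ε, hε, hmax⟩ := (isCompact_Icc.inter_right hcl).exists_isGreatest
    ⟨δ, Set.left_mem_Icc.2 hδ.1.2, hδ.2⟩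
  refine ⟨ε, ⟨⟨hδ.1.1.trans_le hε.1.1, hε.1.2⟩, hε.2⟩, fun ε' hε' => ?_⟩
  rcases le_total ε' δ with h | h
  · exact h.trans hε.1.1
  · exact hmax ⟨⟨h, hε'.1.2⟩, hε'.2⟩

theorem div_max_le_optCost (hQ : Q.PosSemidef) (hR : R.PosDef) (hP : P.PosSemidef) (hα : 0 ≤ α)
    (hI₀ : I₀.Nonempty) (hpos : ∀ i ∈ I₀, 0 < i) (x : Fin n → ℝ) :
    α / (I₀.max' hI₀ : ℝ) ≤ optCost A B Q R α P I₀ hI₀ x := by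
  refine Finset.le_inf' _ _ fun i hi => ?_
  have h1 : α / (I₀.max' hI₀ : ℝ) ≤ α / i :=
    div_le_div_of_nonneg_left hα (by exact_mod_cast hpos i hi)
      (by exact_mod_cast I₀.le_max' i hi)
  exact h1.trans (le_add_of_nonneg_right
    (sqNorm_nonneg (posSemidef_costMatrix hQ hR hP (hpos i hi)) x))

theorem iterate_constant_input {x : ℕ → Fin n → ℝ} {u : ℕ → Fin m → ℝ} {v : Fin m → ℝ} {t i : ℕ}
    (hdyn : ∀ k, x (k + 1) = A *ᵥ x k + B *ᵥ u k) (hu : ∀ k, t ≤ k → k < t + i → u k = v) :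
    x (t + i) = liftA A i *ᵥ x t + liftB A B i *ᵥ v := by
  induction i with
  | zero => simp [liftA, liftB]
  | succ i ih =>
    have hB : liftB A B (i + 1) = A * liftB A B i + B := by
      simp [liftB, Finset.sum_range_succ', pow_succ', Matrix.mul_sum, Matrix.mul_assoc]
    rw [← add_assoc, hdyn, hu (t + i) (by omega) (by omega),
      ih fun k h1 h2 => hu k h1 (by omega), hB, liftA, liftA, pow_succ', mulVec_add, add_mulVec,
      mulVec_mulVec, mulVec_mulVec, add_assoc]

theorem IsClosedLoop.optCost_succ_le {x : ℕ → Fin n → ℝ} {u : ℕ → Fin m → ℝ} {t I : ℕ → ℕ} {p : ℕ}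
    (h : IsClosedLoop A B Q R α P I₀ x u t I) (hP : P = costMatrix A B Q R P p) (hp : p ∈ I₀)
    (hα : 0 ≤ α) (hI₀ : I₀.Nonempty) (hpos : ∀ i ∈ I₀, 0 < i)
    (hε : ε ∈ decayRates A B Q R P I₀) (j : ℕ) :
    optCost A B Q R α P I₀ hI₀ (x (t (j + 1))) ≤
      (1 - ε) * optCost A B Q R α P I₀ hI₀ (x (t j)) +
        α * (1 / (p : ℝ) - (1 - ε) * (1 / (I₀.max' hI₀ : ℝ))) := by
  have hx : x (t (j + 1)) =
      (liftA A (I j) - liftB A B (I j) * gain A B Q R P (I j)) *ᵥ x (t j) := by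
    rw [h.next_sample, ← liftA_mulVec_add_liftB_mulVec_gain]
    exact iterate_constant_input h.dynamics fun k h1 h2 =>
      h.input j k h1 (by rwa [h.next_sample])
  have hopt : cost A B Q R α P (I j) (x (t j)) ≤ optCost A B Q R α P I₀ hI₀ (x (t j)) :=
    Finset.le_inf' _ _ (h.wait_optimal j)
  -- The waiting time `p` is a candidate at the next sample.
  have hle : optCost A B Q R α P I₀ hI₀ (x (t (j + 1))) ≤ α / p + sqNorm P (x (t (j + 1))) := by
    have h1 : optCost A B Q R α P I₀ hI₀ (x (t (j + 1))) ≤ cost A B Q R α P p (x (t (j + 1))) :=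
      Finset.inf'_le _ hp
    rwa [cost, ← hP] at h1
  have hdec := sqNorm_nonneg (hε.2 (I j) (h.wait_mem j)) (x (t j))
  rw [sqNorm_sub, sqNorm_smul, sqNorm_transpose_mul_mul, ← hx] at hdec
  -- Lowering `α / I j` to `α / γ` makes the constant independent of the chosen waiting time.
  have hγ : α / (I₀.max' hI₀ : ℝ) ≤ α / I j :=
    div_le_div_of_nonneg_left hα (by exact_mod_cast hpos _ (h.wait_mem j))
      (by exact_mod_cast I₀.le_max' _ (h.wait_mem j))
  have hε1 : 0 ≤ 1 - ε := sub_nonneg.2 hε.1.2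
  have h2 : (1 - ε) * (α / (I₀.max' hI₀ : ℝ) + sqNorm (costMatrix A B Q R P (I j)) (x (t j))) ≤
      (1 - ε) * optCost A B Q R α P I₀ hI₀ (x (t j)) :=
    mul_le_mul_of_nonneg_left (le_trans (by rw [cost]; gcongr) hopt) hε1
  have h3 : α * (1 / (p : ℝ) - (1 - ε) * (1 / (I₀.max' hI₀ : ℝ))) =
      α / p - (1 - ε) * (α / (I₀.max' hI₀ : ℝ)) := by ring
  rw [h3]
  linarith

/-- The affine map has fixed point `c / ε`, and the excess over it shrinks at least like `(1 - ε) ^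
j`. With values in `EReal` the limsup needs no boundedness of `v`. -/
theorem limsup_le_of_affine_contraction {v : ℕ → ℝ} {c : ℝ} (hε : ε ∈ Set.Ioc (0 : ℝ) 1)
    (hv : ∀ j, v (j + 1) ≤ (1 - ε) * v j + c) :
    limsup (fun j => ((v j : ℝ) : EReal)) atTop ≤ ((c / ε : ℝ) : EReal) := by
  have hε0 : ε ≠ 0 := hε.1.ne'
  have hb (j : ℕ) : v j ≤ c / ε + (1 - ε) ^ j * (v 0 - c / ε) := by
    induction j with
    | zero => simp
    | succ j ih =>
      have h1 := mul_le_mul_of_nonneg_left ih (sub_nonneg.2 hε.2)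
      calc v (j + 1) ≤ (1 - ε) * v j + c := hv j
        _ ≤ (1 - ε) * (c / ε + (1 - ε) ^ j * (v 0 - c / ε)) + c := by gcongr
        _ = _ := by field_simp; ring
  have hlim : Tendsto (fun j => c / ε + (1 - ε) ^ j * (v 0 - c / ε)) atTop (𝓝 (c / ε)) := by
    simpa using ((tendsto_pow_atTop_nhds_zero_of_lt_one (sub_nonneg.2 hε.2)
      (by linarith [hε.1])).mul_const (v 0 - c / ε)).const_add (c / ε)
  have hlim' := (continuous_coe_real_ereal.tendsto (c / ε)).comp hlim
  calc limsup (fun j => ((v j : ℝ) : EReal)) atTop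
      ≤ limsup (fun j => ((c / ε + (1 - ε) ^ j * (v 0 - c / ε) : ℝ) : EReal)) atTop :=
        limsup_le_limsup (.of_forall fun j => EReal.coe_le_coe_iff.2 (hb j))
    _ = _ := hlim'.limsup_eq

end ClosedLoop

end SelfTriggered

open SelfTriggered in
theorem theorem2 {n m : ℕ}
    (A : Matrix (Fin n) (Fin n) ℝ) (B : Matrix (Fin n) (Fin m) ℝ)
    (Q : Matrix (Fin n) (Fin n) ℝ) (R : Matrix (Fin m) (Fin m) ℝ)
    (hQ : Q.PosDef) (hR : R.PosDef) (hAB : Controllable A B)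
    (α : ℝ) (hα : 0 ≤ α)
    (I₀ : Finset ℕ) (hI₀ : I₀.Nonempty) (hI₀_pos : ∀ i ∈ I₀, 0 < i)
    (p : ℕ) (hp : IsGreatest (admissiblePeriods A I₀) p)
    (hABp : Controllable (liftA A p) (liftB A B p)) :
    ∃ P : Matrix (Fin n) (Fin n) ℝ,
      (IsRiccatiSolution A B Q R p P ∧ ∀ P', IsRiccatiSolution A B Q R p P' → P' = P) ∧
      ∃ ε : ℝ, IsGreatest (decayRates A B Q R P I₀) ε ∧
        ∀ (x : ℕ → Fin n → ℝ) (u : ℕ → Fin m → ℝ) (t I : ℕ → ℕ),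
          IsClosedLoop A B Q R α P I₀ x u t I →
            (∀ k, α / (I₀.max' hI₀ : ℝ) ≤ optCost A B Q R α P I₀ hI₀ (x k)) ∧
            Filter.limsup (fun j => ((optCost A B Q R α P I₀ hI₀ (x (t j)) : ℝ) : EReal))
                Filter.atTop ≤
              ((α / ε * (1 / (p : ℝ) - (1 - ε) * (1 / (I₀.max' hI₀ : ℝ))) : ℝ) : EReal) := by
  have hp0 : 0 < p := hI₀_pos p hp.1.1
  obtain ⟨P, hP⟩ := exists_isRiccatiSolution hQ.posSemidef hR hp0 hABp
  obtain ⟨ε, hε⟩ := exists_isGreatest_decayRates (A := A) (B := B) hQ hR hP.1 hI₀_pos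
  refine ⟨P, ⟨hP, fun P' hP' => hP'.unique hP hQ hR hp0⟩, ε, hε, fun x u t I h => ⟨fun k =>
    div_max_le_optCost hQ.posSemidef hR hP.1 hα hI₀ hI₀_pos (x k), ?_⟩⟩
  rw [div_mul_eq_mul_div]
  exact limsup_le_of_affine_contraction hε.1.1
    (h.optCost_succ_le hP.2 hp.1.1 hα hI₀ hI₀_pos hε.1)
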